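/- Let $\mathcal M=(S,A,T,R,\beta)$ be a Markov decision process with finite state space $S$, finite non-empty sets $A(s)$ of available actions, transition probabilities $T(s'\mid s,a)$, rewards $R(s,a,s')\in\mathbb R$ and initial distribution $\beta$, together with finitely many steady-state specifications $(L_i,[l_i,u_i])$, $L_i\subseteq S$. Write $R(s,a)=\sum_{s'}T(s'\mid s,a)R(s,a,s')$. The transition graph of $\mathcal M$ has an edge $s\to s'$ iff $T(s'\mid s,a)>0$ for some $a\in A(s)$. A terminal strongly connected component (TSCC) is a strongly connected component of the transition graph that is reachable from some state $s_0$ with $\beta_{s_0}>0$ and has no outgoing edges; $r_1(\mathcal M),\dots,r_m(\mathcal M)$ are the TSCCs of $\mathcal M$, $r(\mathcal M)$ is their union and $\bar r(\mathcal M)=S\setminus r(\mathcal M)$. A stationary policy $\pi$ assigns to each $s$ a probability distribution $\pi(\cdot\mid s)$ on $A(s)$; it induces the Markov chain $\mathcal M_\pi$ with transition probabilities $T_\pi(s'\mid s)=\sum_{a\in A(s)}T(s'\mid s,a)\pi(a\mid s)$ and initial distribution $\beta$, whose TSCCs and their union $r(\mathcal M_\pi)$ are defined in the same way. Let $\Pi_{CPU}$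 be the set of stationary policies $\pi$ such that $r(\mathcal M_\pi)\subseteq r(\mathcal M)$ and, for every $k$, exactly one TSCC of $\mathcal M_\pi$ is contained in $r_k(\mathcal M)$. The steady-state distribution of $\pi$ is $$\mathrm{Pr}^\infty_\pi(s,a)=\lim_{n\to\infty}\frac1n\sum_{t=1}^n \Pr(S_t=s,A_t=a\mid\beta,\pi),\qquad s\in S,\ a\in A(s);$$ $\pi$ meets the specifications if this limit exists for all $s\in S$, $a\in A(s)$ and $l_i\le\sum_{s\in L_i}\sum_{a\in A(s)}\mathrm{Pr}^\infty_\pi(s,a)\le u_i$ for all $i$. The expected average reward of $\pi$ is $R^\infty_\pi(\beta)=\liminf_{n\to\infty}\frac1n\sum_{t=1}^n\mathbb E[R(S_t,A_t)]$, where $S_0\sim\beta$ and actions are chosen by $\pi$. Let $Q_0$ be the set of $(x,y)=(x_{sa},y_{sa})_{s\in S,a\in A(s)}$ with $x_{sa}\in[0,1]$, $y_{sa}\ge 0$, $$\sum_{s}\sum_{a\in A(s)}x_{sa}T(s'\mid s,a)=\sum_{a\in A(s')}x_{s'a}\quad\forall s'\in S,$$ $$\sum_{s}\sum_{a\in A(s)}y_{sa}T(s'\mid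 s,a)=\sum_{a\in A(s')}(x_{s'a}+y_{s'a})-\beta_{s'}\quad\forall s'\in S,$$ $$\sum_{f\in\bar r(\mathcal M)}\sum_{a\in A(f)}x_{fa}=0 .$$ Let $\mathrm{LP}_3$ be the problem of maximizing $\sum_{s}\sum_{a\in A(s)}x_{sa}R(s,a)$ over all $(x,y)\in Q_0$ with $l_i\le\sum_{s\in L_i}\sum_{a\in A(s)}x_{sa}\le u_i$ for all $i$. Put $x_s=\sum_{a\in A(s)}x_{sa}$ and $y_s=\sum_{a\in A(s)}y_{sa}$. **Theorem.** Let $(x,y)$ be an optimal solution of $\mathrm{LP}_3$. Suppose that for every TSCC $r_k(\mathcal M)$ the digraph with vertex set $V_k^+(x)=\{s\in r_k(\mathcal M):x_s>0\}$, and with an edge $s\to s'$ whenever $x_{sa}T(s'\mid s,a)>0$ for some $a\in A(s)$, is strongly connected (in particular $V_k^+(x)\neq\emptyset$). Let $\pi=\pi(x,y)$ be any stationary policy with $\pi(a\mid s)=x_{sa}/x_s$ if $x_s>0$, $\pi(a\mid s)=y_{sa}/y_s$ if $x_s=0<y_s$, and $\pi(\cdot\mid s)$ arbitrary if $x_s=y_s=0$.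 Then $\pi\in\Pi_{CPU}$, $\pi$ meets the specifications, and $R^\infty_{\pi'}(\beta)\le R^\infty_\pi(\beta)$ for every $\pi'\in\Pi_{CPU}$ that meets the specifications. -/

import Mathlib

open scoped BigOperators
open Filter Topology

noncomputable section

/-- A Markov decision process `(S, A, T, R, β)` with finite state space `S`.
`act s` is the (finite, non-empty) set `A(s)` of actions available in state `s`,
`T s a s'` is `T(s' | s, a)`, and `R s a s'` is the reward of the transition. Values of `T` and `R`
at actions outside `A(s)` are never used. -/
structure MDP (S A : Type*) [Fintype S] where
  act : S → Finset A
  act_nonempty : ∀ s, (act s).Nonempty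
  T : S → A → S → ℝ
  T_nonneg : ∀ s, ∀ a ∈ act s, ∀ s', 0 ≤ T s a s'
  T_sum : ∀ s, ∀ a ∈ act s, ∑ s', T s a s' = 1
  R : S → A → S → ℝ
  β : S → ℝ
  β_nonneg : ∀ s, 0 ≤ β s
  β_sum : ∑ s, β s = 1

/-- A labeled MDP: an MDP with finitely many labels `L i ⊆ S` and
steady-state specifications `(L i, [l i, u i])`. -/
structure LMDP (S A : Type*) [Fintype S] extends MDP S A where
  nL : ℕ
  L : Fin nL → Finset S
  l : Fin nL → ℝ
  u : Fin nL → ℝ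

/-- `C` is a strongly connected component of the digraph with edge relation `E`: a maximal set of
vertices any two of which are joined by directed (possibly empty) paths in both directions. -/
def IsSCC {S : Type*} (E : S → S → Prop) (C : Set S) : Prop :=
  Maximal (fun D : Set S => ∀ s ∈ D, ∀ s' ∈ D, Relation.ReflTransGen E s s') C

/-- `C` is a terminal strongly connected component of the digraph `E` with initial distribution
`β`: an SCC that can be reached from some state `s₀` with `β s₀ > 0` and that has no outgoing
edges. -/
def IsTSCC {S : Type*} (E : S → S → Prop) (β : S → ℝ) (C : Set S) : Prop :=
  IsSCC E C ∧
  (∃ s₀, 0 < β s₀ ∧ ∃ s ∈ C, Relation.ReflTransGen E s₀ s) ∧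
  (∀ s ∈ C, ∀ s', E s s' → s' ∈ C)

/-- The digraph with vertex set `V` and the edges of `E` between vertices of `V` is strongly
connected (in particular it has a vertex). -/
def StronglyConnectedOn {S : Type*} (E : S → S → Prop) (V : Set S) : Prop :=
  V.Nonempty ∧
  ∀ s ∈ V, ∀ s' ∈ V, Relation.ReflTransGen (fun v w => v ∈ V ∧ w ∈ V ∧ E v w) s s'

namespace MDP

variable {S A : Type*} [Fintype S] (M : MDP S A)

/-- Edges of the transition graph of the MDP. -/
def edge (s s' : S) : Prop := ∃ a ∈ M.act s, 0 < M.T s a s'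

/-- `C` is one of the TSCCs `r_k(M)` of the MDP. -/
def IsTSCCOf (C : Set S) : Prop := IsTSCC M.edge M.β C

/-- The union `r(M)` of all TSCCs of the MDP. -/
def recSet : Set S := {s | ∃ C, M.IsTSCCOf C ∧ s ∈ C}

/-- Stationary policies: `π s a` is `π(a | s)`, a probability distribution on `A(s)`. -/
def IsPolicy (π : S → A → ℝ) : Prop :=
  ∀ s, (∀ a, 0 ≤ π s a) ∧ (∀ a, a ∉ M.act s → π s a = 0) ∧ ∑ a ∈ M.act s, π s a = 1

/-- Transition probabilities `T_π(s' | s)` of the Markov chain `M_π` induced by `π`. -/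
def chainT (π : S → A → ℝ) (s s' : S) : ℝ := ∑ a ∈ M.act s, M.T s a s' * π s a

/-- Edges of the transition graph of `M_π`. -/
def chainEdge (π : S → A → ℝ) (s s' : S) : Prop := 0 < M.chainT π s s'

/-- `C` is one of the TSCCs of the Markov chain `M_π`. -/
def IsTSCCOfChain (π : S → A → ℝ) (C : Set S) : Prop := IsTSCC (M.chainEdge π) M.β C

/-- The union `r(M_π)` of all TSCCs of `M_π`. -/
def chainRecSet (π : S → A → ℝ) : Set S := {s | ∃ C, M.IsTSCCOfChain π C ∧ s ∈ C}

/-- The set `Π_CPU` of class-preserving-up-to-unichain policies: stationary policies with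
`r(M_π) ⊆ r(M)` for which every TSCC of `M` contains exactly one TSCC of `M_π`. -/
def CPU : Set (S → A → ℝ) :=
  {π | M.IsPolicy π ∧ M.chainRecSet π ⊆ M.recSet ∧
    ∀ C, M.IsTSCCOf C → ∃! D : Set S, M.IsTSCCOfChain π D ∧ D ⊆ C}

/-- `Pr(S_t = s | β, π)`, where `S_0` has law `β`. -/
def stateProb (π : S → A → ℝ) : ℕ → S → ℝ
  | 0 => M.β
  | t + 1 => fun s' => ∑ s, stateProb π t s * M.chainT π s s'

/-- `Pr(S_t = s, A_t = a | β, π)`. -/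
def stateActProb (π : S → A → ℝ) (t : ℕ) (s : S) (a : A) : ℝ := M.stateProb π t s * π s a

/-- `p` is the steady-state distribution `Pr^∞_π` (occupation measure) of `π`: the Cesàro limit of
the state-action probabilities exists and equals `p s a` for all `s` and `a ∈ A(s)`. -/
def IsSteadyState (π p : S → A → ℝ) : Prop :=
  ∀ s, ∀ a ∈ M.act s,
    Tendsto (fun n : ℕ => (1 / (n : ℝ)) * ∑ t ∈ Finset.Icc 1 n, M.stateActProb π t s a)
      atTop (𝓝 (p s a))

/-- `R(s, a) = ∑_{s'} T(s' | s, a) R(s, a, s')`. -/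
def meanR (s : S) (a : A) : ℝ := ∑ s', M.T s a s' * M.R s a s'

/-- Expected average reward `R^∞_π(β) = liminf_n (1/n) ∑_{t=1}^n E[R(S_t, A_t)]`. -/
def avgReward (π : S → A → ℝ) : ℝ :=
  liminf (fun n : ℕ => (1 / (n : ℝ)) * ∑ t ∈ Finset.Icc 1 n,
    ∑ s, ∑ a ∈ M.act s, M.stateActProb π t s a * M.meanR s a) atTop

/-- The total `z_s = ∑_{a ∈ A(s)} z_{sa}`. -/
def tot (z : S → A → ℝ) (s : S) : ℝ := ∑ a ∈ M.act s, z s a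

/-- The polyhedron `Q_0`. -/
structure InQ0 (x y : S → A → ℝ) : Prop where
  balance : ∀ s', ∑ s, ∑ a ∈ M.act s, x s a * M.T s a s' = ∑ a ∈ M.act s', x s' a
  flow : ∀ s', ∑ s, ∑ a ∈ M.act s, y s a * M.T s a s' =
    ∑ a ∈ M.act s', (x s' a + y s' a) - M.β s'
  trans : ∑ᶠ f ∈ M.recSetᶜ, ∑ a ∈ M.act f, x f a = 0
  x_mem : ∀ s, ∀ a ∈ M.act s, x s a ∈ Set.Icc (0 : ℝ) 1
  y_nonneg : ∀ s, ∀ a ∈ M.act s, 0 ≤ y s a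

/-- The linear objective `∑_s ∑_{a ∈ A(s)} x_{sa} ∑_{s'} T(s' | s, a) R(s, a, s')`. -/
def objective (x : S → A → ℝ) : ℝ := ∑ s, ∑ a ∈ M.act s, x s a * M.meanR s a

/-- `π` is a stationary policy of the form `π(x, y)`: it equals `x_{sa} / x_s` where `x_s > 0`,
`y_{sa} / y_s` where `x_s = 0` and `y_s > 0`, and is arbitrary elsewhere. -/
def IsPolicyFrom (x y π : S → A → ℝ) : Prop :=
  M.IsPolicy π ∧
  (∀ s, 0 < M.tot x s → ∀ a ∈ M.act s, π s a = x s a / M.tot x s) ∧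
  (∀ s, ¬ 0 < M.tot x s → 0 < M.tot y s → ∀ a ∈ M.act s, π s a = y s a / M.tot y s)

/-- Edges of the support digraph of `x`: the transitions possible under actions with
`x_{sa} > 0`. -/
def supportEdge (x : S → A → ℝ) (s s' : S) : Prop :=
  ∃ a ∈ M.act s, 0 < x s a ∧ 0 < M.T s a s'

/-- The vertices `{s ∈ C : x_s > 0}` of the support digraph of `x` inside `C`. -/
def supportVerts (x : S → A → ℝ) (C : Set S) : Set S := {s | s ∈ C ∧ 0 < M.tot x s}

end MDP

namespace LMDP

variable {S A : Type*} [Fintype S] (M : LMDP S A)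

/-- The specification constraints on a vector `x` of state-action values. -/
def SpecConstraints (x : S → A → ℝ) : Prop :=
  ∀ i, M.l i ≤ ∑ s ∈ M.L i, ∑ a ∈ M.act s, x s a ∧
    ∑ s ∈ M.L i, ∑ a ∈ M.act s, x s a ≤ M.u i

/-- Feasible points of `LP_3`. -/
def FeasibleLP3 (x y : S → A → ℝ) : Prop := M.InQ0 x y ∧ M.SpecConstraints x

/-- Optimal solutions of `LP_3`. -/
def OptimalLP3 (x y : S → A → ℝ) : Prop :=
  M.FeasibleLP3 x y ∧ ∀ x' y', M.FeasibleLP3 x' y' → M.objective x' ≤ M.objective x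

/-- `π` meets the specifications: its steady-state distribution exists and satisfies the
steady-state constraints. -/
def MeetsSpecs (π : S → A → ℝ) : Prop :=
  ∃ p, M.IsSteadyState π p ∧ M.SpecConstraints p

end LMDP

end

/-!
The chain of `π(x, y)` follows `x` where `x` is positive and `y` elsewhere, so `x` is stationary for
it; the point is that the limit mass `k` of the chain started in `β` distributes over the classes
`V_C⁺(x)` as `x` does. Let `h s` be the probability of absorption in `V_C⁺(x)` from `s`. It is
harmonic for the chain, and testing the flow constraint of `y` against `h` gives `x ≤ k` in total
mass on `V_C⁺(x)`. The negative part of the stationary vector `k - x` is stationary again, so on the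
strongly connected set `V_C⁺(x)` it is positive everywhere or zero, and the former is excluded by
the mass inequality. Hence `x ≤ k` everywhere, and both have total mass one, so `k = x`.

Conversely, for any policy with limit mass `k`, the equation `β - k = w - w P` has a nonnegative
solution `w`: a solution of Cesàro mean zero is nonnegative at transient states, and a multiple of
`k` can be added to it. The policy's steady state thus extends to a point of `Q₀`, and its average
reward is the objective value there.
-/

/-! ### Cesàro limits of linear maps -/

section Cesaro

open Bornology

variable {E : Type*} [NormedAddCommGroup E] [NormedSpace ℝ E] {f : E →ₗ[ℝ] E} {v k w : E}

/-- `k` is the limit of the averages `(v + f v + ⋯ + f^[n-1] v) / n`. -/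
def IsCesaroLimit (f : E →ₗ[ℝ] E) (v k : E) : Prop :=
  Tendsto (fun n => birkhoffAverage ℝ f id n v) atTop (𝓝 k)

/-- All orbits of `f` are bounded; in finite dimension this says that `f` is power bounded. -/
def OrbitsBounded (f : E →ₗ[ℝ] E) : Prop :=
  ∀ v, IsBounded (Set.range fun n : ℕ => f^[n] v)

theorem IsCesaroLimit.of_isFixed (hk : f k = k) : IsCesaroLimit f k k :=
  Function.IsFixedPt.tendsto_birkhoffAverage ℝ hk id

theorem IsCesaroLimit.unique {l : E} (hk : IsCesaroLimit f v k) (hl : IsCesaroLimit f v l) :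
    k = l :=
  tendsto_nhds_unique hk hl

theorem IsCesaroLimit.add {l : E} (hv : IsCesaroLimit f v k) (hw : IsCesaroLimit f w l) :
    IsCesaroLimit f (v + w) (k + l) := by
  simpa [IsCesaroLimit, birkhoffAverage, birkhoffSum, Finset.sum_add_distrib] using
    Tendsto.add hv hw

theorem IsCesaroLimit.sub_apply_self (hw : IsBounded (Set.range fun n : ℕ => f^[n] w)) :
    IsCesaroLimit f (w - f w) 0 := by
  have h : Tendsto (fun n => -(birkhoffAverage ℝ f id n (f w) - birkhoffAverage ℝ f id n w))
      atTop (𝓝 (-0)) :=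
    (tendsto_birkhoffAverage_apply_sub_birkhoffAverage ℝ (by simpa using hw)).neg
  simpa [IsCesaroLimit, birkhoffAverage, birkhoffSum, Finset.sum_sub_distrib, smul_sub,
    iterate_map_sub] using h

theorem IsCesaroLimit.mem_of_forall_iterate_mem (h : IsCesaroLimit f v k) {K : Set E}
    (hK : Convex ℝ K) (hcl : IsClosed K) (hv : ∀ n, f^[n] v ∈ K) : k ∈ K := by
  refine hcl.mem_of_tendsto h ?_
  filter_upwards [eventually_gt_atTop 0] with n hn
  simp only [birkhoffAverage, birkhoffSum, id, Finset.smul_sum]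
  refine hK.sum_mem (fun _ _ => by positivity) ?_ fun t _ => hv t
  simp [hn.ne']

theorem IsCesaroLimit.mem_of_mapsTo (h : IsCesaroLimit f v k) {K : Set E} (hK : Convex ℝ K)
    (hcl : IsClosed K) (hf : Set.MapsTo f K K) (hv : v ∈ K) : k ∈ K :=
  h.mem_of_forall_iterate_mem hK hcl fun n => hf.iterate n hv

theorem IsCesaroLimit.apply (h : IsCesaroLimit f v k)
    (hv : IsBounded (Set.range fun n : ℕ => f^[n] v)) : IsCesaroLimit f (f v) k := by
  have hsub := tendsto_birkhoffAverage_apply_sub_birkhoffAverage ℝ (g := id) (by simpa using hv)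
  simpa only [IsCesaroLimit, sub_add_cancel, zero_add] using hsub.add h

namespace OrbitsBounded

theorem disjoint_ker_range (hf : OrbitsBounded f) :
    Disjoint (LinearMap.ker (1 - f)) (LinearMap.range (1 - f)) := by
  rw [Submodule.disjoint_def]
  rintro _ hk ⟨w, rfl⟩
  have hfixed : f (w - f w) = w - f w := (sub_eq_zero.1 hk).symm
  exact (IsCesaroLimit.of_isFixed hfixed).unique (IsCesaroLimit.sub_apply_self (hf w))

variable [FiniteDimensional ℝ E]

theorem isCompl_ker_range (hf : OrbitsBounded f) :
    IsCompl (LinearMap.ker (1 - f)) (LinearMap.range (1 - f)) := by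
  refine ⟨hf.disjoint_ker_range, codisjoint_iff.2 ?_⟩
  refine Submodule.eq_top_of_disjoint _ _ ?_ hf.disjoint_ker_range
  rw [add_comm, LinearMap.finrank_range_add_finrank_ker]

theorem exists_add_sub_apply (hf : OrbitsBounded f) (v : E) :
    ∃ k w, f k = k ∧ v = k + (w - f w) := by
  obtain ⟨k, hk, _, ⟨w, rfl⟩, h⟩ :=
    Submodule.mem_sup.1 (hf.isCompl_ker_range.sup_eq_top ▸ Submodule.mem_top (x := v))
  exact ⟨k, w, (sub_eq_zero.1 hk).symm, h.symm⟩

theorem exists_isCesaroLimit (hf : OrbitsBounded f) (v : E) : ∃ k, IsCesaroLimit f v k := by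
  obtain ⟨k, w, hk, rfl⟩ := hf.exists_add_sub_apply v
  exact ⟨k + 0, (IsCesaroLimit.of_isFixed hk).add (.sub_apply_self (hf w))⟩

end OrbitsBounded

variable [FiniteDimensional ℝ E]

theorem IsCesaroLimit.apply_eq (h : IsCesaroLimit f v k) (hf : OrbitsBounded f) : f k = k := by
  obtain ⟨l, w, hl, rfl⟩ := hf.exists_add_sub_apply v
  have hlim := (IsCesaroLimit.of_isFixed hl).add (.sub_apply_self (hf w))
  rwa [h.unique hlim, add_zero]

theorem IsCesaroLimit.exists_potential (h : IsCesaroLimit f v k) (hf : OrbitsBounded f) :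
    ∃ w, v - k = w - f w ∧ IsCesaroLimit f w 0 := by
  obtain ⟨l, w, hl, rfl⟩ := hf.exists_add_sub_apply v
  obtain ⟨m, u, hm, rfl⟩ := hf.exists_add_sub_apply w
  have hk := h.unique ((IsCesaroLimit.of_isFixed hl).add (.sub_apply_self (hf _)))
  refine ⟨u - f u, ?_, .sub_apply_self (hf u)⟩
  simp only [hk, map_add, hm, add_zero]
  abel

end Cesaro

/-! ### Closed classes of a digraph -/

section Digraph

open Relation

variable {S : Type*} {E : S → S → Prop} {B C : Set S} {s s' : S}

/-- No edge of the digraph `E` leaves `B`. -/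
def ForwardClosed (E : S → S → Prop) (B : Set S) : Prop :=
  ∀ s ∈ B, ∀ s', E s s' → s' ∈ B

theorem ForwardClosed.mem_of_reflTransGen (hB : ForwardClosed E B) (hs : s ∈ B)
    (h : ReflTransGen E s s') : s' ∈ B := by
  induction h with
  | refl => exact hs
  | tail _ hE ih => exact hB _ ih _ hE

theorem ForwardClosed.isSCC (hB : ForwardClosed E B) (hne : B.Nonempty)
    (hconn : ∀ s ∈ B, ∀ s' ∈ B, ReflTransGen E s s') : IsSCC E B :=
  let ⟨s, hs⟩ := hne
  ⟨hconn, fun _D hD hBD t ht => hB.mem_of_reflTransGen hs (hD s (hBD hs) t ht)⟩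

theorem IsSCC.eq_of_mem (hB : IsSCC E B) (hC : IsSCC E C) (hsB : s ∈ B) (hsC : s ∈ C) :
    B = C := by
  have hunion : ∀ t ∈ B ∪ C, ∀ t' ∈ B ∪ C, ReflTransGen E t t' := by
    have hs : ∀ t ∈ B ∪ C, ReflTransGen E t s ∧ ReflTransGen E s t := by
      rintro t (ht | ht)
      · exact ⟨hB.prop t ht s hsB, hB.prop s hsB t ht⟩
      · exact ⟨hC.prop t ht s hsC, hC.prop s hsC t ht⟩
    exact fun t ht t' ht' => (hs t ht).1.trans (hs t' ht').2
  rw [hB.eq_of_subset hunion Set.subset_union_left, ← hC.eq_of_subset hunion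
    Set.subset_union_right]

end Digraph

/-! ### Stochastic matrices -/

section Stochastic

open Matrix Relation

variable {S : Type*} {P : Matrix S S ℝ} {v w k p h : S → ℝ} {B V : Set S} {s s' : S}

/-- The digraph of a matrix with nonnegative entries. -/
def posEdge (P : Matrix S S ℝ) (s s' : S) : Prop := 0 < P s s'

theorem ForwardClosed.apply_eq_zero (hB : ForwardClosed (posEdge P) B)
    (hP : ∀ s s', 0 ≤ P s s') (hs : s ∈ B) (hs' : s' ∉ B) : P s s' = 0 :=
  ((hP s s').eq_or_lt.resolve_right fun hpos => hs' (hB s hs s' hpos)).symm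

variable [Fintype S]

theorem eq_of_le_of_dotProduct_one_eq (hle : v ≤ w) (hsum : v ⬝ᵥ 1 = w ⬝ᵥ 1) : v = w := by
  simp only [dotProduct_one] at hsum
  exact funext fun s =>
    (Finset.sum_eq_sum_iff_of_le fun s _ => hle s).1 hsum s (Finset.mem_univ s)

theorem vecMul_mono (hP : ∀ s s', 0 ≤ P s s') (hvw : v ≤ w) : v ᵥ* P ≤ w ᵥ* P :=
  fun s' => dotProduct_le_dotProduct_of_nonneg_right hvw fun s => hP s s'

theorem mulVec_mono (hP : ∀ s s', 0 ≤ P s s') (hvw : v ≤ w) : P *ᵥ v ≤ P *ᵥ w :=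
  fun s => dotProduct_le_dotProduct_of_nonneg_left hvw (hP s)

theorem vecMul_nonneg_of_nonneg (hP : ∀ s s', 0 ≤ P s s') (hv : 0 ≤ v) : 0 ≤ v ᵥ* P := by
  simpa using vecMul_mono hP hv

theorem pos_of_vecMul_eq_of_reflTransGen (hP : ∀ s s', 0 ≤ P s s') (hp : 0 ≤ p)
    (hst : p ᵥ* P = p) (hs : 0 < p s) (hreach : ReflTransGen (posEdge P) s s') : 0 < p s' := by
  induction hreach with
  | refl => exact hs
  | @tail t t' _ htt' ih =>
    rw [← hst]
    exact Finset.sum_pos' (fun s _ => mul_nonneg (hp s) (hP s t'))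
      ⟨t, Finset.mem_univ t, mul_pos ih htt'⟩

theorem IsCesaroLimit.nonneg (hk : IsCesaroLimit P.vecMulLinear v k)
    (hP : ∀ s s', 0 ≤ P s s') (hv : 0 ≤ v) : 0 ≤ k :=
  hk.mem_of_mapsTo (convex_Ici 0) isClosed_Ici (fun _ => vecMul_nonneg_of_nonneg hP) hv

theorem IsCesaroLimit.dotProduct_eq (hk : IsCesaroLimit P.vecMulLinear v k)
    (hh : P *ᵥ h = h) : k ⬝ᵥ h = v ⬝ᵥ h := by
  refine hk.mem_of_mapsTo (K := {z | z ⬝ᵥ h = v ⬝ᵥ h})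
    (convex_hyperplane ⟨fun _ _ => add_dotProduct .., fun _ _ => smul_dotProduct ..⟩ _)
    (isClosed_eq (by fun_prop) continuous_const) (fun z hz => ?_) rfl
  simpa [← dotProduct_mulVec, hh] using hz

variable [DecidableEq S]

theorem vecMul_dotProduct_one (hP : P ∈ rowStochastic ℝ S) (v : S → ℝ) :
    (v ᵥ* P) ⬝ᵥ 1 = v ⬝ᵥ 1 := by
  rw [← dotProduct_mulVec, hP.2]

theorem dotProduct_one_eq_of_potential (hP : P ∈ rowStochastic ℝ S)
    (hpot : v - k = w - w ᵥ* P) : k ⬝ᵥ 1 = v ⬝ᵥ 1 := by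
  refine (sub_eq_zero.1 ?_).symm
  rw [← sub_dotProduct, hpot, sub_dotProduct, vecMul_dotProduct_one hP, sub_self]

theorem vecMul_eq_of_le_vecMul (hP : P ∈ rowStochastic ℝ S) (hv : v ≤ v ᵥ* P) : v ᵥ* P = v :=
  (eq_of_le_of_dotProduct_one_eq hv (vecMul_dotProduct_one hP v).symm).symm

/-- The mass outside a closed set cannot increase, so if it is preserved nothing flows in. -/
theorem ForwardClosed.vecMul_indicator_compl (hB : ForwardClosed (posEdge P) B)
    (hP : P ∈ rowStochastic ℝ S) (hp : 0 ≤ p) (hst : p ᵥ* P = p) :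
    Bᶜ.indicator p ᵥ* P = Bᶜ.indicator p := by
  refine vecMul_eq_of_le_vecMul hP fun s' => ?_
  by_cases hs' : s' ∈ B
  · simpa [hs'] using
      vecMul_nonneg_of_nonneg hP.1 (Set.indicator_nonneg fun s _ => hp s) s'
  · rw [Set.indicator_of_mem hs']
    refine (congrFun hst s').symm.trans_le (Finset.sum_le_sum fun s _ => ?_)
    by_cases hs : s ∈ B <;> simp [hs, hB.apply_eq_zero hP.1, hs']

theorem vecMul_negPart (hP : P ∈ rowStochastic ℝ S) (hst : p ᵥ* P = p) : p⁻ ᵥ* P = p⁻ := by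
  refine vecMul_eq_of_le_vecMul hP (sup_le ?_ (vecMul_nonneg_of_nonneg hP.1 (negPart_nonneg p)))
  calc -p = (-p) ᵥ* P := by rw [neg_vecMul, hst]
    _ ≤ p⁻ ᵥ* P := vecMul_mono hP.1 (neg_le_negPart p)

theorem reflTransGen_symm_of_vecMul_eq (hP : P ∈ rowStochastic ℝ S) (hp : 0 ≤ p)
    (hst : p ᵥ* P = p) (hs : 0 < p s) (hreach : ReflTransGen (posEdge P) s s') :
    ReflTransGen (posEdge P) s' s := by
  by_contra hnot
  have hclosed : ForwardClosed (posEdge P) {t | ReflTransGen (posEdge P) s' t} :=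
    fun t ht t' htt' => ReflTransGen.tail ht htt'
  have hpos := pos_of_vecMul_eq_of_reflTransGen hP.1 (Set.indicator_nonneg fun t _ => hp t)
    (hclosed.vecMul_indicator_compl hP hp hst) (by simpa [hnot] using hs) hreach
  simp [ReflTransGen.refl] at hpos

/-- The negative part of `p` is stationary too, so on `V` it vanishes or is positive
everywhere. -/
theorem nonneg_of_vecMul_eq_of_dotProduct_indicator_nonneg (hP : P ∈ rowStochastic ℝ S)
    (hst : p ᵥ* P = p) (hV : ∀ s ∈ V, ∀ s' ∈ V, ReflTransGen (posEdge P) s s')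
    (hmass : 0 ≤ p ⬝ᵥ V.indicator 1) (hs : s ∈ V) : 0 ≤ p s := by
  by_contra! hneg
  have hV_neg : ∀ t ∈ V, p t < 0 := fun t ht => by
    simpa using pos_of_vecMul_eq_of_reflTransGen (s := s) hP.1 (negPart_nonneg p)
      (vecMul_negPart hP hst) (by simpa using hneg) (hV s hs t ht)
  refine hmass.not_gt (Finset.sum_neg' (fun t _ => ?_) ⟨s, Finset.mem_univ s, by simpa [hs]⟩)
  by_cases ht : t ∈ V
  · simpa [ht] using (hV_neg t ht).le
  · simp [ht]

theorem ForwardClosed.indicator_le_mulVec (hB : ForwardClosed (posEdge P) B)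
    (hP : P ∈ rowStochastic ℝ S) : B.indicator 1 ≤ P *ᵥ B.indicator 1 := by
  have hnonneg : (0 : S → ℝ) ≤ B.indicator 1 := Set.indicator_nonneg fun _ _ => zero_le_one
  refine Set.indicator_le' (fun s hs => ?_) fun s _ => by
    simpa using mulVec_mono hP.1 hnonneg s
  refine (congrFun hP.2 s).symm.trans_le (Finset.sum_le_sum fun s' _ => ?_)
  by_cases hs' : s' ∈ B <;> simp [hs', hB.apply_eq_zero hP.1 hs]

theorem orbitsBounded_mulVecLin (hP : ∀ n s s', |(P ^ n) s s'| ≤ 1) :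
    OrbitsBounded P.mulVecLin := by
  intro v
  refine isBounded_iff_forall_norm_le.2 ⟨∑ s, |v s|, ?_⟩
  rintro _ ⟨n, rfl⟩
  simp only [← Module.End.coe_pow]
  rw [← toLin'_apply', ← toLin'_pow, toLin'_apply]
  refine (pi_norm_le_iff_of_nonneg (by positivity)).2 fun s => ?_
  refine (Finset.abs_sum_le_sum_abs _ _).trans (Finset.sum_le_sum fun s' _ => ?_)
  rw [abs_mul]
  exact mul_le_of_le_one_left (abs_nonneg _) (hP n s s')

theorem abs_pow_apply_le_one (hP : P ∈ rowStochastic ℝ S) (n : ℕ) (s s' : S) :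
    |(P ^ n) s s'| ≤ 1 := by
  have hPn := pow_mem hP n
  rw [abs_of_nonneg (hPn.1 s s')]
  exact le_one_of_mem_rowStochastic hPn

theorem orbitsBounded_mulVecLin_of_mem (hP : P ∈ rowStochastic ℝ S) :
    OrbitsBounded P.mulVecLin :=
  orbitsBounded_mulVecLin (abs_pow_apply_le_one hP)

theorem orbitsBounded_vecMulLinear_of_mem (hP : P ∈ rowStochastic ℝ S) :
    OrbitsBounded P.vecMulLinear := by
  rw [← mulVecLin_transpose]
  refine orbitsBounded_mulVecLin fun n s s' => ?_
  rw [← transpose_pow, transpose_apply]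
  exact abs_pow_apply_le_one hP n s' s


end Stochastic

/-! ### Recurrence and absorption -/

section Recurrence

open Matrix Relation

variable {S : Type*} [Fintype S] {P : Matrix S S ℝ} {v k w h : S → ℝ} {B C : Set S} {s s' : S}

theorem IsCesaroLimit.eq_zero_of_notMem (hk : IsCesaroLimit P.vecMulLinear v k)
    (hP : ∀ s s', 0 ≤ P s s') (hB : ForwardClosed (posEdge P) B) (hv : ∀ s ∉ B, v s = 0)
    (hs : s ∉ B) : k s = 0 := by
  refine hk.mem_of_mapsTo (K := Bᶜ.pi fun _ => {0}) (convex_pi fun _ _ => convex_singleton 0)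
    (isClosed_set_pi fun _ _ => isClosed_singleton) (fun z hz s' hs' => ?_) hv s hs
  refine Finset.sum_eq_zero fun s _ => mul_eq_zero.2 ?_
  by_cases hs : s ∈ B
  · exact .inr (hB.apply_eq_zero hP hs hs')
  · exact .inl (hz s hs)

theorem dotProduct_indicator_one_pos_iff (hv : 0 ≤ v) :
    0 < v ⬝ᵥ B.indicator 1 ↔ ∃ s ∈ B, 0 < v s := by
  have hterm : ∀ s, 0 < v s * B.indicator 1 s ↔ s ∈ B ∧ 0 < v s := fun s => by
    by_cases hs : s ∈ B <;> simp [hs]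
  simp only [← hterm]
  refine (Finset.sum_pos_iff_of_nonneg fun s _ => ?_).trans (by simp)
  exact mul_nonneg (hv s) (Set.indicator_nonneg (fun _ _ => zero_le_one) s)

/-- The asymptotic fraction `h s` of time spent in `B` by the chain `P` started at `s`. If no edge
leaves `B`, it is the probability of absorption in `B`. -/
def IsAbsorptionProb (P : Matrix S S ℝ) (B : Set S) (h : S → ℝ) : Prop :=
  IsCesaroLimit P.mulVecLin (B.indicator 1) h

theorem IsAbsorptionProb.eq_zero_of_mem (hh : IsAbsorptionProb P B h) (hP : ∀ s s', 0 ≤ P s s')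
    (hC : ForwardClosed (posEdge P) C) (hBC : Disjoint B C) (hs : s ∈ C) : h s = 0 := by
  refine IsCesaroLimit.mem_of_mapsTo hh (K := C.pi fun _ => {0})
    (convex_pi fun _ _ => convex_singleton 0) (isClosed_set_pi fun _ _ => isClosed_singleton)
    (fun z hz s hs => ?_) (fun s hs => Set.indicator_of_notMem (hBC.notMem_of_mem_right hs) 1) s hs
  refine Finset.sum_eq_zero fun s' _ => mul_eq_zero.2 ?_
  by_cases hs' : s' ∈ C
  · exact .inr (hz s' hs')
  · exact .inl (hC.apply_eq_zero hP hs hs')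

theorem IsAbsorptionProb.dotProduct_eq (hh : IsAbsorptionProb P B h) (hk : k ᵥ* P = k) :
    k ⬝ᵥ h = k ⬝ᵥ B.indicator 1 := by
  refine IsCesaroLimit.mem_of_mapsTo hh (K := {z | k ⬝ᵥ z = k ⬝ᵥ B.indicator 1})
    (convex_hyperplane ⟨dotProduct_add k, fun _ _ => dotProduct_smul ..⟩ _)
    (isClosed_eq (by fun_prop) continuous_const) (fun z hz => ?_) rfl
  simpa [dotProduct_mulVec, hk] using hz

theorem iterate_vecMul_le_of_potential (hP : ∀ s s', 0 ≤ P s s') (hv : 0 ≤ v)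
    (hk : k ᵥ* P = k) (hw : v - k = w - w ᵥ* P) (n : ℕ) :
    P.vecMulLinear^[n] w ≤ w + n • k := by
  have hstep : w ᵥ* P ≤ w + k := by
    rw [show w ᵥ* P = w + k - v by linear_combination hw]
    exact sub_le_self _ hv
  induction n with
  | zero => simp
  | succ n ih =>
    rw [Function.iterate_succ_apply']
    calc P.vecMulLinear^[n] w ᵥ* P ≤ (w + n • k) ᵥ* P := vecMul_mono hP ih
      _ = w ᵥ* P + n • k := by rw [add_vecMul, smul_vecMul, hk]
      _ ≤ w + (n + 1) • k := by rw [succ_nsmul', ← add_assoc]; gcongr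

theorem exists_smul_add_nonneg {ι : Type*} [Finite ι] {k w : ι → ℝ} (hk : 0 ≤ k)
    (hw : ∀ s, k s = 0 → 0 ≤ w s) : ∃ c : ℝ, 0 ≤ w + c • k := by
  cases nonempty_fintype ι
  refine ⟨∑ s, |w s| / k s, fun s => ?_⟩
  rcases (hk s).eq_or_lt with hks | hks
  · simpa [← hks] using hw s hks.symm
  · have hle : |w s| / k s ≤ ∑ s, |w s| / k s :=
      Finset.single_le_sum (f := fun s => |w s| / k s)
        (fun s _ => div_nonneg (abs_nonneg _) (hk s)) (Finset.mem_univ s)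
    have := (div_le_iff₀ hks).1 hle
    simp only [Pi.zero_apply, Pi.add_apply, Pi.smul_apply, smul_eq_mul]
    linarith [neg_abs_le (w s)]

variable [DecidableEq S]

theorem IsCesaroLimit.vecMul_eq (hk : IsCesaroLimit P.vecMulLinear v k)
    (hP : P ∈ rowStochastic ℝ S) : k ᵥ* P = k :=
  hk.apply_eq (orbitsBounded_vecMulLinear_of_mem hP)

theorem IsCesaroLimit.vecMul (hk : IsCesaroLimit P.vecMulLinear v k)
    (hP : P ∈ rowStochastic ℝ S) : IsCesaroLimit P.vecMulLinear (v ᵥ* P) k :=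
  hk.apply (orbitsBounded_vecMulLinear_of_mem hP v)

theorem ForwardClosed.dotProduct_indicator_le_of_isCesaroLimit
    (hB : ForwardClosed (posEdge P) B) (hk : IsCesaroLimit P.vecMulLinear v k)
    (hP : P ∈ rowStochastic ℝ S) (hv : 0 ≤ v) :
    v ⬝ᵥ B.indicator 1 ≤ k ⬝ᵥ B.indicator 1 := by
  refine (hk.mem_of_mapsTo (K := {z | 0 ≤ z} ∩ {z | v ⬝ᵥ B.indicator 1 ≤ z ⬝ᵥ B.indicator 1})
    ((convex_Ici 0).inter ?_) (isClosed_Ici.inter ?_)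
    (fun z ⟨hz, hmass⟩ => ⟨vecMul_nonneg_of_nonneg hP.1 hz, ?_⟩) ⟨hv, le_refl (v ⬝ᵥ _)⟩).2
  · exact convex_halfSpace_ge ⟨fun _ _ => add_dotProduct .., fun _ _ => smul_dotProduct ..⟩ _
  · exact isClosed_le continuous_const (by fun_prop)
  · calc v ⬝ᵥ B.indicator 1 ≤ z ⬝ᵥ B.indicator 1 := hmass
      _ ≤ z ⬝ᵥ P *ᵥ B.indicator 1 :=
        dotProduct_le_dotProduct_of_nonneg_left (hB.indicator_le_mulVec hP) hz
      _ = (z ᵥ* P) ⬝ᵥ B.indicator 1 := dotProduct_mulVec ..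

theorem IsCesaroLimit.exists_pos_of_reflTransGen (hk : IsCesaroLimit P.vecMulLinear v k)
    (hP : P ∈ rowStochastic ℝ S) (hv : 0 ≤ v) (hs : 0 < v s)
    (hreach : ReflTransGen (posEdge P) s s') :
    ∃ w, IsCesaroLimit P.vecMulLinear w k ∧ 0 ≤ w ∧ 0 < w s' := by
  induction hreach with
  | refl => exact ⟨v, hk, hv, hs⟩
  | @tail t t' _ htt' ih =>
    obtain ⟨w, hw, hw0, hwt⟩ := ih
    exact ⟨w ᵥ* P, hw.vecMul hP, vecMul_nonneg_of_nonneg hP.1 hw0,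
      Finset.sum_pos' (fun s _ => mul_nonneg (hw0 s) (hP.1 s t'))
        ⟨t, Finset.mem_univ t, mul_pos hwt htt'⟩⟩

theorem IsCesaroLimit.pos_of_isTSCC (hk : IsCesaroLimit P.vecMulLinear v k)
    (hP : P ∈ rowStochastic ℝ S) (hv : 0 ≤ v) (hB : IsTSCC (posEdge P) v B) (hs : s ∈ B) :
    0 < k s := by
  obtain ⟨hscc, ⟨s₀, hs₀, t, ht, hreach⟩, hclosed⟩ := hB
  obtain ⟨w, hwk, hw, hwt⟩ := hk.exists_pos_of_reflTransGen hP hv hs₀ hreach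
  have hmass := ForwardClosed.dotProduct_indicator_le_of_isCesaroLimit hclosed hwk hP hw
  obtain ⟨r, hr, hkr⟩ := (dotProduct_indicator_one_pos_iff (hk.nonneg hP.1 hv)).1
    (((dotProduct_indicator_one_pos_iff hw).2 ⟨t, ht, hwt⟩).trans_le hmass)
  exact pos_of_vecMul_eq_of_reflTransGen hP.1 (hk.nonneg hP.1 hv) (hk.vecMul_eq hP) hkr
    (hscc.prop r hr s hs)

theorem IsCesaroLimit.exists_isTSCC_of_pos (hk : IsCesaroLimit P.vecMulLinear v k)
    (hP : P ∈ rowStochastic ℝ S) (hv : 0 ≤ v) (hs : 0 < k s) :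
    ∃ B, IsTSCC (posEdge P) v B ∧ s ∈ B := by
  have hreach : ∃ s₀, 0 < v s₀ ∧ ReflTransGen (posEdge P) s₀ s := by
    by_contra hnot
    refine hs.ne' (hk.eq_zero_of_notMem (B := {t | ∃ s₀, 0 < v s₀ ∧ ReflTransGen (posEdge P) s₀ t})
      hP.1 (fun t ⟨s₀, hs₀, ht⟩ t' htt' => ⟨s₀, hs₀, ht.tail htt'⟩) (fun t ht => ?_) hnot)
    exact ((hv t).eq_or_lt.resolve_right fun hpos => ht ⟨t, hpos, .refl⟩).symm
  have hclosed : ForwardClosed (posEdge P) {t | ReflTransGen (posEdge P) s t} :=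
    fun t ht t' htt' => ReflTransGen.tail ht htt'
  obtain ⟨s₀, hs₀, hs₀s⟩ := hreach
  refine ⟨_, ⟨hclosed.isSCC ⟨s, .refl⟩ fun t ht t' ht' => ?_, ⟨s₀, hs₀, s, .refl, hs₀s⟩, hclosed⟩,
    .refl⟩
  exact (reflTransGen_symm_of_vecMul_eq hP (hk.nonneg hP.1 hv) (hk.vecMul_eq hP) hs ht).trans ht'

theorem IsCesaroLimit.pos_iff_exists_isTSCC (hk : IsCesaroLimit P.vecMulLinear v k)
    (hP : P ∈ rowStochastic ℝ S) (hv : 0 ≤ v) :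
    0 < k s ↔ ∃ B, IsTSCC (posEdge P) v B ∧ s ∈ B :=
  ⟨hk.exists_isTSCC_of_pos hP hv, fun ⟨_, hB, hs⟩ => hk.pos_of_isTSCC hP hv hB hs⟩

theorem exists_isAbsorptionProb (hP : P ∈ rowStochastic ℝ S) (B : Set S) :
    ∃ h, IsAbsorptionProb P B h :=
  (orbitsBounded_mulVecLin_of_mem hP).exists_isCesaroLimit _

namespace IsAbsorptionProb

theorem mulVec_eq (hh : IsAbsorptionProb P B h) (hP : P ∈ rowStochastic ℝ S) : P *ᵥ h = h :=
  IsCesaroLimit.apply_eq hh (orbitsBounded_mulVecLin_of_mem hP)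

theorem le_one (hh : IsAbsorptionProb P B h) (hP : P ∈ rowStochastic ℝ S) : h ≤ 1 :=
  IsCesaroLimit.mem_of_mapsTo hh (convex_Iic 1) isClosed_Iic
    (fun _ hz => (mulVec_mono hP.1 hz).trans_eq hP.2)
    (Set.indicator_le_self' fun _ _ => zero_le_one)

theorem eq_one_of_mem (hh : IsAbsorptionProb P B h) (hP : P ∈ rowStochastic ℝ S)
    (hB : ForwardClosed (posEdge P) B) (hs : s ∈ B) : h s = 1 := by
  have hle : B.indicator 1 ≤ h :=
    IsCesaroLimit.mem_of_mapsTo hh (convex_Ici _) isClosed_Ici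
      (fun _ hz => (hB.indicator_le_mulVec hP).trans (mulVec_mono hP.1 hz)) Set.self_mem_Ici
  exact (hh.le_one hP s).antisymm (by simpa [hs] using hle s)

end IsAbsorptionProb

/-- A potential `w` with mean zero is nonnegative where `k` vanishes, since its orbit decreases
there; adding a multiple of `k` makes it nonnegative everywhere. -/
theorem IsCesaroLimit.exists_nonneg_potential (hk : IsCesaroLimit P.vecMulLinear v k)
    (hP : P ∈ rowStochastic ℝ S) (hv : 0 ≤ v) : ∃ y, 0 ≤ y ∧ v - k = y - y ᵥ* P := by
  obtain ⟨w, hw, hw0⟩ := hk.exists_potential (orbitsBounded_vecMulLinear_of_mem hP)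
  have hfix := hk.vecMul_eq hP
  have hw_nonneg : ∀ s, k s = 0 → 0 ≤ w s := fun s hs =>
    hw0.mem_of_forall_iterate_mem (K := {z | z s ≤ w s})
      (convex_halfSpace_le ⟨fun _ _ => rfl, fun _ _ => rfl⟩ _)
      (isClosed_le (continuous_apply s) continuous_const) fun n => by
        simpa [hs] using iterate_vecMul_le_of_potential hP.1 hv hfix hw n s
  obtain ⟨c, hc⟩ := exists_smul_add_nonneg (hk.nonneg hP.1 hv) hw_nonneg
  refine ⟨w + c • k, hc, ?_⟩
  rw [hw, add_vecMul, smul_vecMul, hfix, add_sub_add_right_eq_sub, vecMulLinear_apply]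

end Recurrence

namespace MDP

open Matrix Relation

variable {S A : Type*} [Fintype S] {M : MDP S A} {x y z π p q : S → A → ℝ} {k w h : S → ℝ}
  {C : Set S} {s s' : S}

/-! ### Flows of state-action vectors -/

/-- The matrix whose `(s, s')` entry is the mass that the state-action vector `z` moves from `s` to
`s'`. The constraints of `Q₀` are statements about its row and column sums. -/
def flux (M : MDP S A) (z : S → A → ℝ) : Matrix S S ℝ :=
  .of fun s s' => ∑ a ∈ M.act s, z s a * M.T s a s'

theorem flux_nonneg (hz : ∀ s, ∀ a ∈ M.act s, 0 ≤ z s a) (s s' : S) : 0 ≤ M.flux z s s' :=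
  Finset.sum_nonneg fun a ha => mul_nonneg (hz s a ha) (M.T_nonneg s a ha s')

theorem flux_mulVec_one (z : S → A → ℝ) : M.flux z *ᵥ 1 = M.tot z := by
  ext s
  rw [mulVec, dotProduct_one]
  refine Finset.sum_comm.trans ?_
  refine Finset.sum_congr rfl fun a ha => ?_
  rw [← Finset.mul_sum, M.T_sum s a ha, mul_one]

theorem flux_mulVec_eq_zero (hC : ForwardClosed M.edge C) (hs : s ∈ C) (hh : ∀ s ∈ C, h s = 0)
    (z : S → A → ℝ) : (M.flux z *ᵥ h) s = 0 := by
  refine Finset.sum_eq_zero fun s' _ => mul_eq_zero.2 ?_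
  by_cases hs' : s' ∈ C
  · exact .inr (hh s' hs')
  · refine .inl (Finset.sum_eq_zero fun a ha => mul_eq_zero.2 (.inr ?_))
    exact ((M.T_nonneg s a ha s').eq_or_lt.resolve_right
      fun hT => hs' (hC s hs s' ⟨a, ha, hT⟩)).symm

theorem tot_nonneg (hz : ∀ s, ∀ a ∈ M.act s, 0 ≤ z s a) : 0 ≤ M.tot z :=
  fun s => Finset.sum_nonneg (hz s)

theorem eq_zero_of_tot_eq_zero (hz : ∀ s, ∀ a ∈ M.act s, 0 ≤ z s a) (hs : M.tot z s = 0) :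
    ∀ a ∈ M.act s, z s a = 0 :=
  (Finset.sum_eq_zero_iff_of_nonneg (hz s)).1 hs

/-! ### The Markov chain of a policy -/

/-- The transition matrix of the chain `M_π`. Its digraph `posEdge` is `M.chainEdge π` by
definition. -/
def chainMatrix (M : MDP S A) (π : S → A → ℝ) : Matrix S S ℝ := .of (M.chainT π)

theorem flux_apply_eq {c : ℝ} (hz : ∀ a ∈ M.act s, z s a = c * π s a) :
    M.flux z s = c • M.chainMatrix π s := by
  ext s'
  simp only [flux, chainMatrix, of_apply, chainT, Pi.smul_apply, smul_eq_mul, Finset.mul_sum]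
  exact Finset.sum_congr rfl fun a ha => by rw [hz a ha]; ring

theorem one_vecMul_flux (hz : ∀ s, ∀ a ∈ M.act s, z s a = k s * π s a) :
    1 ᵥ* M.flux z = k ᵥ* M.chainMatrix π := by
  ext s'
  exact Finset.sum_congr rfl fun s _ => by simp [flux_apply_eq (hz s)]

theorem stateProb_eq_iterate (π : S → A → ℝ) (t : ℕ) :
    M.stateProb π t = (M.chainMatrix π).vecMulLinear^[t] M.β := by
  induction t with
  | zero => rfl
  | succ t ih =>
    rw [Function.iterate_succ_apply', ← ih]
    rfl

namespace IsPolicy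

theorem tot_mul (hπ : M.IsPolicy π) (k : S → ℝ) : M.tot (fun s a => k s * π s a) = k := by
  ext s
  simp only [tot, ← Finset.mul_sum, (hπ s).2.2, mul_one]

theorem le_one (hπ : M.IsPolicy π) {a : A} (ha : a ∈ M.act s) : π s a ≤ 1 :=
  (Finset.single_le_sum (fun a _ => (hπ s).1 a) ha).trans_eq (hπ s).2.2

theorem chainMatrix_mem [DecidableEq S] (hπ : M.IsPolicy π) :
    M.chainMatrix π ∈ rowStochastic ℝ S := by
  refine mem_rowStochastic_iff_sum.2 ⟨fun s s' => Finset.sum_nonneg fun a ha =>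
    mul_nonneg (M.T_nonneg s a ha s') ((hπ s).1 a), fun s => ?_⟩
  simp only [chainMatrix, of_apply, chainT]
  rw [Finset.sum_comm, ← (hπ s).2.2]
  refine Finset.sum_congr rfl fun a ha => ?_
  rw [← Finset.sum_mul, M.T_sum s a ha, one_mul]

theorem edge_of_chainEdge (hπ : M.IsPolicy π) (hs : M.chainEdge π s s') : M.edge s s' := by
  obtain ⟨a, ha, hpos⟩ := Finset.exists_lt_of_sum_lt (f := fun _ => (0 : ℝ))
    (Finset.sum_const_zero.trans_lt hs)
  exact ⟨a, ha, pos_of_mul_pos_left hpos ((hπ s).1 a)⟩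

theorem chainEdge_of_pos (hπ : M.IsPolicy π) {a : A} (ha : a ∈ M.act s) (hπa : 0 < π s a)
    (hT : 0 < M.T s a s') : M.chainEdge π s s' :=
  Finset.sum_pos' (fun a ha => mul_nonneg (M.T_nonneg s a ha s') ((hπ s).1 a))
    ⟨a, ha, mul_pos hT hπa⟩

theorem forwardClosed_chainEdge (hπ : M.IsPolicy π) (hC : ForwardClosed M.edge C) :
    ForwardClosed (M.chainEdge π) C :=
  fun s hs s' hss' => hC s hs s' (hπ.edge_of_chainEdge hss')

theorem exists_isCesaroLimit (hπ : M.IsPolicy π) :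
    ∃ k, IsCesaroLimit (M.chainMatrix π).vecMulLinear M.β k := by
  classical
  exact (orbitsBounded_vecMulLinear_of_mem hπ.chainMatrix_mem).exists_isCesaroLimit _

theorem pos_iff_mem_chainRecSet (hπ : M.IsPolicy π)
    (hk : IsCesaroLimit (M.chainMatrix π).vecMulLinear M.β k) :
    0 < k s ↔ s ∈ M.chainRecSet π := by
  classical
  exact hk.pos_iff_exists_isTSCC hπ.chainMatrix_mem M.β_nonneg

theorem isSteadyState (hπ : M.IsPolicy π)
    (hk : IsCesaroLimit (M.chainMatrix π).vecMulLinear M.β k) :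
    M.IsSteadyState π fun s a => k s * π s a := by
  classical
  intro s a _
  have hlim := tendsto_pi_nhds.1 (hk.vecMul hπ.chainMatrix_mem) s
  refine (hlim.mul_const (π s a)).congr fun n => ?_
  simp only [stateActProb, stateProb_eq_iterate, ← Finset.sum_mul, birkhoffAverage, birkhoffSum,
    Finset.sum_apply, Pi.smul_apply, smul_eq_mul, id, one_div, mul_assoc]
  rw [← Finset.Ico_add_one_right_eq_Icc, Finset.sum_Ico_eq_sum_range, Nat.add_sub_cancel]
  simp only [add_comm 1, Function.iterate_succ_apply, vecMulLinear_apply]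

end IsPolicy

theorem IsSteadyState.congr_right (hp : M.IsSteadyState π p)
    (hpq : ∀ s, ∀ a ∈ M.act s, p s a = q s a) : M.IsSteadyState π q :=
  fun s a ha => hpq s a ha ▸ hp s a ha

theorem IsSteadyState.avgReward_eq (hp : M.IsSteadyState π p) :
    M.avgReward π = M.objective p := by
  refine Tendsto.liminf_eq ?_
  have hlim : Tendsto (fun n : ℕ => ∑ s, ∑ a ∈ M.act s, ((1 / (n : ℝ)) *
      ∑ t ∈ Finset.Icc 1 n, M.stateActProb π t s a) * M.meanR s a) atTop
      (𝓝 (M.objective p)) :=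
    tendsto_finsetSum _ fun s _ => tendsto_finsetSum _ fun a ha => (hp s a ha).mul_const _
  refine hlim.congr fun n => ?_
  simp only [Finset.mul_sum, Finset.sum_mul, mul_assoc]
  rw [Finset.sum_comm]
  exact Finset.sum_congr rfl fun s _ => Finset.sum_comm

/-! ### Points of `Q₀` -/

namespace InQ0

theorem x_nonneg (hQ : M.InQ0 x y) (s : S) (a : A) (ha : a ∈ M.act s) : 0 ≤ x s a :=
  (hQ.x_mem s a ha).1

theorem one_vecMul_flux_x (hQ : M.InQ0 x y) : 1 ᵥ* M.flux x = M.tot x := by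
  ext s'
  simpa [vecMul, dotProduct, flux, tot] using hQ.balance s'

theorem one_vecMul_flux_y (hQ : M.InQ0 x y) : 1 ᵥ* M.flux y = M.tot x + M.tot y - M.β := by
  ext s'
  simpa [vecMul, dotProduct, flux, tot, Finset.sum_add_distrib] using hQ.flow s'

theorem mem_recSet_of_tot_pos (hQ : M.InQ0 x y) (hs : 0 < M.tot x s) : s ∈ M.recSet := by
  by_contra hrec
  have hsum := hQ.trans
  rw [finsum_mem_eq_finite_toFinset_sum _ (Set.toFinite _)] at hsum
  exact hs.ne' ((Finset.sum_eq_zero_iff_of_nonneg fun s _ => tot_nonneg hQ.x_nonneg s).1 hsum s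
    ((Set.Finite.mem_toFinset _).2 hrec))

/-- The flow constraint of `y`, tested against `h`. -/
theorem tot_dotProduct_add (hQ : M.InQ0 x y) (h : S → ℝ) :
    M.tot x ⬝ᵥ h + M.tot y ⬝ᵥ h = M.β ⬝ᵥ h + 1 ⬝ᵥ M.flux y *ᵥ h := by
  rw [dotProduct_mulVec, hQ.one_vecMul_flux_y, sub_dotProduct, add_dotProduct]
  ring

theorem tot_dotProduct_one (hQ : M.InQ0 x y) : M.tot x ⬝ᵥ 1 = M.β ⬝ᵥ 1 := by
  have hflow := hQ.tot_dotProduct_add 1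
  rwa [flux_mulVec_one, dotProduct_comm 1, add_left_inj] at hflow

theorem tot_dotProduct_le (hQ : M.InQ0 x y) (hh : M.flux y *ᵥ h ≤ M.tot y * h) :
    M.tot x ⬝ᵥ h ≤ M.β ⬝ᵥ h := by
  have hflow := hQ.tot_dotProduct_add h
  have hle : 1 ⬝ᵥ M.flux y *ᵥ h ≤ M.tot y ⬝ᵥ h := by
    rw [one_dotProduct]
    exact Finset.sum_le_sum fun s _ => hh s
  linarith

end InQ0

theorem IsPolicy.inQ0 (hπ : M.IsPolicy π) (hrec : ∀ s, 0 < k s → s ∈ M.recSet) (hk : 0 ≤ k)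
    (hst : k ᵥ* M.chainMatrix π = k) (hw : 0 ≤ w)
    (hpot : M.β - k = w - w ᵥ* M.chainMatrix π) :
    M.InQ0 (fun s a => k s * π s a) (fun s a => w s * π s a) := by
  classical
  have hmass : ∑ s, k s = 1 := by
    rw [← dotProduct_one, dotProduct_one_eq_of_potential hπ.chainMatrix_mem hpot, dotProduct_one,
      M.β_sum]
  have hflux : ∀ (v : S → ℝ) (s' : S),
      ∑ s, ∑ a ∈ M.act s, v s * π s a * M.T s a s' = (v ᵥ* M.chainMatrix π) s' := fun v s' => by
    rw [← one_vecMul_flux (z := fun s a => v s * π s a) fun _ _ _ => rfl]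
    simp [vecMul, dotProduct, flux]
  have htot : ∀ (v : S → ℝ) s, ∑ a ∈ M.act s, v s * π s a = v s :=
    fun v => congrFun (hπ.tot_mul v)
  constructor
  · intro s'
    rw [hflux, hst, htot]
  · intro s'
    have hpot' : M.β s' - k s' = w s' - (w ᵥ* M.chainMatrix π) s' := congrFun hpot s'
    rw [hflux, Finset.sum_add_distrib, htot, htot]
    linear_combination hpot'
  · refine finsum_mem_eq_zero_of_forall_eq_zero fun s hs => ?_
    rw [htot]
    exact ((hk s).eq_or_lt.resolve_right fun hpos => hs (hrec s hpos)).symm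
  · intro s a ha
    have hks : k s ≤ 1 := hmass ▸ Finset.single_le_sum (fun s _ => hk s) (Finset.mem_univ s)
    exact ⟨mul_nonneg (hk s) ((hπ s).1 a), mul_le_one₀ hks ((hπ s).1 a) (hπ.le_one ha)⟩
  · exact fun s a _ => mul_nonneg (hw s) ((hπ s).1 a)

theorem IsPolicy.exists_isSteadyState_inQ0 (hπ : M.IsPolicy π)
    (hrec : M.chainRecSet π ⊆ M.recSet) : ∃ p q, M.IsSteadyState π p ∧ M.InQ0 p q := by
  classical
  obtain ⟨k, hk⟩ := hπ.exists_isCesaroLimit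
  obtain ⟨w, hw, hpot⟩ := hk.exists_nonneg_potential hπ.chainMatrix_mem M.β_nonneg
  have hk_nonneg := hk.nonneg hπ.chainMatrix_mem.1 M.β_nonneg
  have hk_rec : ∀ s, 0 < k s → s ∈ M.recSet :=
    fun s hs => hrec ((hπ.pos_iff_mem_chainRecSet hk).1 hs)
  exact ⟨_, _, hπ.isSteadyState hk,
    hπ.inQ0 hk_rec hk_nonneg (hk.vecMul_eq hπ.chainMatrix_mem) hw hpot⟩

/-! ### The policy of a point of `Q₀` -/

namespace IsPolicyFrom

theorem x_eq (hπ : M.IsPolicyFrom x y π) (hQ : M.InQ0 x y) (s : S) :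
    ∀ a ∈ M.act s, x s a = M.tot x s * π s a := by
  intro a ha
  rcases (tot_nonneg hQ.x_nonneg s).eq_or_lt with h0 | hpos
  · rw [← h0, eq_zero_of_tot_eq_zero hQ.x_nonneg h0.symm a ha, Pi.zero_apply, zero_mul]
  · rw [hπ.2.1 s hpos a ha, mul_div_cancel₀ _ hpos.ne']

theorem y_eq (hπ : M.IsPolicyFrom x y π) (hQ : M.InQ0 x y) (hs : ¬ 0 < M.tot x s) :
    ∀ a ∈ M.act s, y s a = M.tot y s * π s a := by
  intro a ha
  rcases (tot_nonneg hQ.y_nonneg s).eq_or_lt with h0 | hpos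
  · rw [← h0, eq_zero_of_tot_eq_zero hQ.y_nonneg h0.symm a ha, Pi.zero_apply, zero_mul]
  · rw [hπ.2.2 s hs hpos a ha, mul_div_cancel₀ _ hpos.ne']

theorem tot_vecMul (hπ : M.IsPolicyFrom x y π) (hQ : M.InQ0 x y) :
    M.tot x ᵥ* M.chainMatrix π = M.tot x := by
  rw [← one_vecMul_flux (hπ.x_eq hQ), hQ.one_vecMul_flux_x]

theorem forwardClosed_supportVerts (hπ : M.IsPolicyFrom x y π) (hQ : M.InQ0 x y)
    (hC : M.IsTSCCOf C) : ForwardClosed (M.chainEdge π) (M.supportVerts x C) := by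
  classical
  intro s ⟨hsC, hs⟩ s' hss'
  exact ⟨hπ.1.forwardClosed_chainEdge hC.2.2 s hsC s' hss',
    pos_of_vecMul_eq_of_reflTransGen hπ.1.chainMatrix_mem.1 (tot_nonneg hQ.x_nonneg)
      (hπ.tot_vecMul hQ) hs (.single hss')⟩

theorem reflTransGen_chainEdge (hπ : M.IsPolicyFrom x y π)
    (hV : StronglyConnectedOn (M.supportEdge x) (M.supportVerts x C)) :
    ∀ s ∈ M.supportVerts x C, ∀ s' ∈ M.supportVerts x C, ReflTransGen (M.chainEdge π) s s' := by
  intro s hs s' hs'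
  refine ReflTransGen.mono ?_ _ _ (hV.2 s hs s' hs')
  rintro v w ⟨hv, -, a, ha, hxa, hT⟩
  exact hπ.1.chainEdge_of_pos ha (hπ.2.1 v hv.2 a ha ▸ div_pos hxa hv.2) hT

theorem isSCC_supportVerts (hπ : M.IsPolicyFrom x y π) (hQ : M.InQ0 x y) (hC : M.IsTSCCOf C)
    (hV : StronglyConnectedOn (M.supportEdge x) (M.supportVerts x C)) :
    IsSCC (M.chainEdge π) (M.supportVerts x C) :=
  (hπ.forwardClosed_supportVerts hQ hC).isSCC hV.1 (hπ.reflTransGen_chainEdge hV)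

/-- Where `x` vanishes, `y` moves along the chain, for which `h` is harmonic. Elsewhere `y` may
move differently, but it cannot leave a terminal component of the MDP: `h` vanishes on those other
than `C`, and takes its maximal value `1` on `V_C⁺(x)`. -/
theorem flux_mulVec_le (hπ : M.IsPolicyFrom x y π) (hQ : M.InQ0 x y) (hC : M.IsTSCCOf C)
    (hh : IsAbsorptionProb (M.chainMatrix π) (M.supportVerts x C) h) :
    M.flux y *ᵥ h ≤ M.tot y * h := by
  classical
  have hP := hπ.1.chainMatrix_mem
  intro s
  by_cases hs : 0 < M.tot x s
  · obtain ⟨D, hD, hsD⟩ := hQ.mem_recSet_of_tot_pos hs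
    by_cases hDC : D = C
    · rw [Pi.mul_apply, hh.eq_one_of_mem hP (hπ.forwardClosed_supportVerts hQ hC) ⟨hDC ▸ hsD, hs⟩,
        mul_one, ← flux_mulVec_one]
      exact mulVec_mono (flux_nonneg hQ.y_nonneg) (hh.le_one hP) s
    · have hdisj : Disjoint (M.supportVerts x C) D :=
        Set.disjoint_left.2 fun t ht htD => hDC (hD.1.eq_of_mem hC.1 htD ht.1)
      have hzero : ∀ t ∈ D, h t = 0 :=
        fun t ht => hh.eq_zero_of_mem hP.1 (hπ.1.forwardClosed_chainEdge hD.2.2) hdisj ht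
      rw [Pi.mul_apply, hzero s hsD, mul_zero, flux_mulVec_eq_zero hD.2.2 hsD hzero]
  · calc (M.flux y *ᵥ h) s = M.tot y s * (M.chainMatrix π *ᵥ h) s := by
          rw [mulVec, flux_apply_eq (hπ.y_eq hQ hs), smul_dotProduct, smul_eq_mul]; rfl
      _ ≤ M.tot y s * h s := by rw [hh.mulVec_eq hP]

theorem tot_dotProduct_le (hπ : M.IsPolicyFrom x y π) (hQ : M.InQ0 x y) (hC : M.IsTSCCOf C)
    (hk : IsCesaroLimit (M.chainMatrix π).vecMulLinear M.β k) :
    M.tot x ⬝ᵥ (M.supportVerts x C).indicator 1 ≤ k ⬝ᵥ (M.supportVerts x C).indicator 1 := by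
  classical
  have hP := hπ.1.chainMatrix_mem
  obtain ⟨h, hh⟩ := exists_isAbsorptionProb hP (M.supportVerts x C)
  calc M.tot x ⬝ᵥ (M.supportVerts x C).indicator 1 = M.tot x ⬝ᵥ h :=
        (hh.dotProduct_eq (hπ.tot_vecMul hQ)).symm
    _ ≤ M.β ⬝ᵥ h := hQ.tot_dotProduct_le (hπ.flux_mulVec_le hQ hC hh)
    _ = k ⬝ᵥ h := (hk.dotProduct_eq (hh.mulVec_eq hP)).symm
    _ = k ⬝ᵥ (M.supportVerts x C).indicator 1 := hh.dotProduct_eq (hk.vecMul_eq hP)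

theorem tot_le (hπ : M.IsPolicyFrom x y π) (hQ : M.InQ0 x y)
    (hconn : ∀ C, M.IsTSCCOf C → StronglyConnectedOn (M.supportEdge x) (M.supportVerts x C))
    (hk : IsCesaroLimit (M.chainMatrix π).vecMulLinear M.β k) : M.tot x ≤ k := by
  classical
  have hP := hπ.1.chainMatrix_mem
  intro s
  by_cases hs : 0 < M.tot x s
  · obtain ⟨C, hC, hsC⟩ := hQ.mem_recSet_of_tot_pos hs
    have hst : (k - M.tot x) ᵥ* M.chainMatrix π = k - M.tot x := by
      rw [sub_vecMul, hk.vecMul_eq hP, hπ.tot_vecMul hQ]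
    have hmass : 0 ≤ (k - M.tot x) ⬝ᵥ (M.supportVerts x C).indicator 1 := by
      rw [sub_dotProduct]
      exact sub_nonneg.2 (hπ.tot_dotProduct_le hQ hC hk)
    have hdiff : 0 ≤ (k - M.tot x) s := nonneg_of_vecMul_eq_of_dotProduct_indicator_nonneg hP hst
      (hπ.reflTransGen_chainEdge (hconn C hC)) hmass ⟨hsC, hs⟩
    exact sub_nonneg.1 hdiff
  · exact (not_lt.1 hs).trans (hk.nonneg hP.1 M.β_nonneg s)

theorem isCesaroLimit_tot (hπ : M.IsPolicyFrom x y π) (hQ : M.InQ0 x y)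
    (hconn : ∀ C, M.IsTSCCOf C → StronglyConnectedOn (M.supportEdge x) (M.supportVerts x C)) :
    IsCesaroLimit (M.chainMatrix π).vecMulLinear M.β (M.tot x) := by
  classical
  obtain ⟨k, hk⟩ := hπ.1.exists_isCesaroLimit
  have hmass : M.tot x ⬝ᵥ 1 = k ⬝ᵥ 1 :=
    hQ.tot_dotProduct_one.trans (hk.dotProduct_eq hπ.1.chainMatrix_mem.2).symm
  rwa [eq_of_le_of_dotProduct_one_eq (hπ.tot_le hQ hconn hk) hmass]

theorem isSteadyState (hπ : M.IsPolicyFrom x y π) (hQ : M.InQ0 x y)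
    (hconn : ∀ C, M.IsTSCCOf C → StronglyConnectedOn (M.supportEdge x) (M.supportVerts x C)) :
    M.IsSteadyState π x :=
  (hπ.1.isSteadyState (hπ.isCesaroLimit_tot hQ hconn)).congr_right
    fun s a ha => (hπ.x_eq hQ s a ha).symm

theorem mem_chainRecSet_iff (hπ : M.IsPolicyFrom x y π) (hQ : M.InQ0 x y)
    (hconn : ∀ C, M.IsTSCCOf C → StronglyConnectedOn (M.supportEdge x) (M.supportVerts x C)) :
    s ∈ M.chainRecSet π ↔ 0 < M.tot x s :=
  (hπ.1.pos_iff_mem_chainRecSet (hπ.isCesaroLimit_tot hQ hconn)).symm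

theorem mem_CPU (hπ : M.IsPolicyFrom x y π) (hQ : M.InQ0 x y)
    (hconn : ∀ C, M.IsTSCCOf C → StronglyConnectedOn (M.supportEdge x) (M.supportVerts x C)) :
    π ∈ M.CPU := by
  have hrec : ∀ {s}, s ∈ M.chainRecSet π ↔ 0 < M.tot x s := hπ.mem_chainRecSet_iff hQ hconn
  refine ⟨hπ.1, fun s hs => hQ.mem_recSet_of_tot_pos (hrec.1 hs), fun C hC => ?_⟩
  have hscc := hπ.isSCC_supportVerts hQ hC (hconn C hC)
  refine ⟨M.supportVerts x C, ⟨?_, fun s hs => hs.1⟩, fun D ⟨hD, hDC⟩ => ?_⟩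
  · obtain ⟨v, hv⟩ := (hconn C hC).1
    obtain ⟨B, hB, hvB⟩ := hrec.2 hv.2
    exact hB.1.eq_of_mem hscc hvB hv ▸ hB
  · obtain ⟨-, -, d, hd, -⟩ := hD.2.1
    exact hD.1.eq_of_mem hscc hd ⟨hDC hd, hrec.1 ⟨D, hD, hd⟩⟩

end IsPolicyFrom

end MDP

theorem LMDP.SpecConstraints.congr {S A : Type*} [Fintype S] {M : LMDP S A} {p q : S → A → ℝ}
    (hp : M.SpecConstraints p) (hpq : ∀ s, ∀ a ∈ M.act s, p s a = q s a) :
    M.SpecConstraints q := by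
  intro i
  rw [← Finset.sum_congr rfl fun s _ => Finset.sum_congr rfl (hpq s)]
  exact hp i

theorem mainTheorem4_general {S A : Type*} [Fintype S] (M : LMDP S A)
    (x y : S → A → ℝ) (hopt : M.OptimalLP3 x y)
    (hconn : ∀ C : Set S, M.IsTSCCOf C →
      StronglyConnectedOn (M.supportEdge x) (M.supportVerts x C))
    (π : S → A → ℝ) (hπ : M.IsPolicyFrom x y π) :
    π ∈ M.CPU ∧ M.MeetsSpecs π ∧
      ∀ π', M.IsPolicy π' → M.chainRecSet π' ⊆ M.recSet → M.MeetsSpecs π' →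
        M.avgReward π' ≤ M.avgReward π := by
  obtain ⟨⟨hQ, hspec⟩, hmax⟩ := hopt
  have hx := hπ.isSteadyState hQ hconn
  refine ⟨hπ.mem_CPU hQ hconn, ⟨x, hx, hspec⟩, fun π' hπ' hrec ⟨p, hp, hpspec⟩ => ?_⟩
  obtain ⟨p', q', hp', hQ'⟩ := hπ'.exists_isSteadyState_inQ0 hrec
  rw [hx.avgReward_eq, hp'.avgReward_eq]
  exact hmax p' q'
    ⟨hQ', hpspec.congr fun s a ha => tendsto_nhds_unique (hp s a ha) (hp' s a ha)⟩

theorem mainTheorem4 {S A : Type*} [Fintype S] (M : LMDP S A)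
    (x y : S → A → ℝ) (hopt : M.OptimalLP3 x y)
    (hconn : ∀ C : Set S, M.IsTSCCOf C →
      StronglyConnectedOn (M.supportEdge x) (M.supportVerts x C))
    (π : S → A → ℝ) (hπ : M.IsPolicyFrom x y π) :
    π ∈ M.CPU ∧ M.MeetsSpecs π ∧
      ∀ π' ∈ M.CPU, M.MeetsSpecs π' → M.avgReward π' ≤ M.avgReward π := by
  obtain ⟨hCPU, hspecs, hmax⟩ := mainTheorem4_general M x y hopt hconn π hπ
  exact ⟨hCPU, hspecs, fun π' hπ' => hmax π' hπ'.1 hπ'.2.1⟩
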